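/- Let $p$ be a prime power, let $\mathbb{F}_p$ be the finite field with $p$ elements, and let $n\ge 0$. In the linear Simon's problem one is given oracle access to an $\mathbb{F}_p$-linear map $f:\mathbb{F}_p^n\to\mathbb{F}_p^n$, promised to satisfy $|\ker f|=1$ or $|\ker f|=p$, and has to decide which of the two holds. A $T$-query quantum algorithm consists of a work register of some finite dimension $m\ge 1$, unitaries $U_0,\dots,U_T$ on $\mathbb{C}^{\mathbb{F}_p^n}\otimes\mathbb{C}^{\mathbb{F}_p^n}\otimes\mathbb{C}^m$ that do not depend on $f$, and an assignment of one of the two answers to each computational basis state; on input $f$ it measures the state $U_T O_f U_{T-1} O_f\cdots U_1 O_f U_0|0\rangle|0\rangle|0\rangle$ in the computational basis and returns the assigned answer, where $O_f:|x\rangle|b\rangle|w\rangle\mapsto|x\rangle|b+f(x)\rangle|w\rangle$. It solves the problem with success probability at least $2/3$ if for every $f$ satisfying the promise it returns the correct answer with probability at least $2/3$. Theorem. There is an absolute constant $c>0$ such that, for every prime power $p$, every $n\ge 0$ and every $T\ge 0$, if some $T$-query quantum algorithm solves the linear Simon's problem over $\mathbb{F}_p^n$ with success probability at least $2/3$, then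 $T\ge c\,n$. In other words, $T=\Omega(n)$. -/

import Mathlib

open scoped Matrix

/-- Computational basis labels `(x, b, w)`: query input register, query output register,
work register of dimension `m`. -/
abbrev BasisIndex (X Y : Type*) (m : ℕ) : Type _ := X × Y × Fin m

/-- Vectors of the Hilbert space `ℂ^X ⊗ ℂ^Y ⊗ ℂ^m`, given by their amplitudes. -/
abbrev StateVec (X Y : Type*) (m : ℕ) : Type _ := BasisIndex X Y m → ℂ

/-- A `T`-query quantum algorithm with oracle access to an unknown function `X → Y`: a work
register of arbitrary finite positive dimension, unitaries `U 0, …, U T` that do not depend on the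
oracle, and a decision read off from the measurement of the final state in the computational
basis. -/
structure QueryAlgorithm (X Y : Type*) [Fintype X] [DecidableEq X] [Fintype Y] [DecidableEq Y]
    (T : ℕ) where
  /-- dimension of the work register -/
  workDim : ℕ
  workDim_pos : 0 < workDim
  /-- the unitaries applied before, between and after the `T` queries -/
  U : Fin (T + 1) → Matrix.unitaryGroup (BasisIndex X Y workDim) ℂ
  /-- the answer returned on each measurement outcome -/
  output : BasisIndex X Y workDim → Bool

/-- The query unitary `|x⟩|b⟩|w⟩ ↦ |x⟩|b + f x⟩|w⟩`, in terms of amplitudes. -/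
def applyOracle {X Y : Type*} [AddGroup Y] {m : ℕ} (f : X → Y) (ψ : StateVec X Y m) :
    StateVec X Y m :=
  fun z => ψ (z.1, z.2.1 - f z.1, z.2.2)

/-- The action of the query unitary on basis vectors. -/
theorem applyOracle_single {X Y : Type*} [DecidableEq X] [DecidableEq Y] [AddGroup Y] {m : ℕ}
    (f : X → Y) (x : X) (b : Y) (w : Fin m) :
    applyOracle f (Pi.single (x, b, w) 1) = Pi.single (x, b + f x, w) 1 := by
  funext z
  obtain ⟨x', b', w'⟩ := z
  simp only [applyOracle, Pi.single_apply, Prod.mk.injEq]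
  refine if_congr ?_ rfl rfl
  constructor
  · rintro ⟨rfl, rfl, rfl⟩
    simp
  · rintro ⟨rfl, rfl, rfl⟩
    simp

namespace QueryAlgorithm

variable {X Y : Type*} [Fintype X] [DecidableEq X] [Fintype Y] [DecidableEq Y] {T : ℕ}

/-- The initial state `|0⟩|0⟩|0⟩`. -/
def initState [Zero X] [Zero Y] (A : QueryAlgorithm X Y T) : StateVec X Y A.workDim :=
  Pi.single (0, 0, ⟨0, A.workDim_pos⟩) 1

/-- The state `U_t O_f U_{t-1} O_f ⋯ U_1 O_f U_0 |0⟩|0⟩|0⟩` after `t` queries to `f`. -/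
def stateAfter [Zero X] [AddGroup Y] (A : QueryAlgorithm X Y T) (f : X → Y) (t : Fin (T + 1)) :
    StateVec X Y A.workDim :=
  Fin.induction (motive := fun _ => StateVec X Y A.workDim)
    ((A.U 0 : Matrix _ _ ℂ) *ᵥ A.initState)
    (fun i ψ => (A.U i.succ : Matrix _ _ ℂ) *ᵥ applyOracle f ψ) t

/-- The state before the measurement, after all `T` queries. -/
def finalState [Zero X] [AddGroup Y] (A : QueryAlgorithm X Y T) (f : X → Y) :
    StateVec X Y A.workDim :=
  A.stateAfter f (Fin.last T)

/-- The probability that the algorithm answers `a` when run with oracle `f`. -/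
noncomputable def outputProb [Zero X] [AddGroup Y] (A : QueryAlgorithm X Y T) (f : X → Y)
    (a : Bool) : ℝ :=
  ∑ z : BasisIndex X Y A.workDim, if A.output z = a then ‖A.finalState f z‖ ^ 2 else 0

end QueryAlgorithm

/-- The algorithm `A` solves the linear Simon problem over `F` in dimension `n` with success
probability at least `δ`: on every `F`-linear `f : F^n → F^n` it answers `true` with probability at
least `δ` if `|ker f| = 1`, and `false` with probability at least `δ` if `|ker f| = |F|`. -/
def SolvesLinearSimon {F : Type*} [Field F] [Fintype F] [DecidableEq F] {n T : ℕ}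
    (A : QueryAlgorithm (Fin n → F) (Fin n → F) T) (δ : ℝ) : Prop :=
  ∀ f : (Fin n → F) →ₗ[F] (Fin n → F),
    (Nat.card (LinearMap.ker f) = 1 → δ ≤ A.outputProb f true) ∧
    (Nat.card (LinearMap.ker f) = Fintype.card F → δ ≤ A.outputProb f false)

/-!
The proof is the polynomial method. For a `T`-query algorithm the probability of answering `true` is
a polynomial of degree at most `2 * T` in the indicator variables `[f x = y]` of the oracle
(`QueryAlgorithm.outputProb_mem_queryPolynomials`).

Let `q` be the size of the field, and average this probability over all oracles `A E B`, where `A`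
and `B` are invertible and `E` is a fixed linear map. A monomial in the indicator variables asks for
prescribed values on a finite set, so its average counts pairs `(A, B)`. After a change of basis the
condition is that `A E B` sends a linearly independent family `x` to a family that is linearly
independent on `r` indices and zero on the remaining `s`. Sorting the pairs by the family `B x`,
and using that the general linear group is transitive on linearly independent families, this count
is a constant times
`∏ i < r, (q ^ n - X * q ^ i) * ∏ i < s, (X - q ^ i)` with `X = |ker E| = q ^ dim (ker E)`
(`exists_natCard_pairs_eq`). Hence the averaged probability is `P (q ^ dim (ker E))` for a univariate
polynomial `P` of degree at most `2 * T` (`exists_sum_queryPolynomial_eq`).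

If the algorithm is correct, then `P 1 ≥ 2 / 3`, `P q ≤ 1 / 3`, and `P (q ^ j)` lies in `[0, 1]` for
all `j ≤ n`. Lagrange interpolation of `P - P q` at `q` and at `2 * T` points `q ^ j` with large
exponents `j` rules this out when `n > 5 * T`: the points are so far from `1` and from one another,
compared with the gap between `1` and `q`, that their coefficients at `1` sum to at most `1 / 4`
(`norm_eval_one_sub_eval_le`).
-/

/-! ### Polynomials bounded on a geometric progression -/

lemma norm_one_sub_pow_le {q : ℕ} (hq : 2 ≤ q) {i j : ℕ} (hij : i ≠ j) :
    ‖(1 : ℂ) - (q : ℂ) ^ i‖ ≤ 2 * ‖(q : ℂ) ^ j - (q : ℂ) ^ i‖ := by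
  have hq' : (2 : ℝ) ≤ q := by exact_mod_cast hq
  have hpos : ∀ k : ℕ, (1 : ℝ) ≤ (q : ℝ) ^ k := fun k => one_le_pow₀ (by linarith)
  have h1 : ‖(1 : ℂ) - (q : ℂ) ^ i‖ = (q : ℝ) ^ i - 1 := by
    have : (1 : ℂ) - (q : ℂ) ^ i = ((1 - (q : ℝ) ^ i : ℝ) : ℂ) := by push_cast; ring
    rw [this, Complex.norm_real, Real.norm_eq_abs, abs_sub_comm, abs_of_nonneg]
    linarith [hpos i]
  have h2 : ‖(q : ℂ) ^ j - (q : ℂ) ^ i‖ = |(q : ℝ) ^ j - (q : ℝ) ^ i| := by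
    have : (q : ℂ) ^ j - (q : ℂ) ^ i = (((q : ℝ) ^ j - (q : ℝ) ^ i : ℝ) : ℂ) := by push_cast; ring
    rw [this, Complex.norm_real, Real.norm_eq_abs]
  rw [h1, h2]
  rcases lt_or_gt_of_ne hij with h | h
  · have h3 : (q : ℝ) ^ (i + 1) ≤ (q : ℝ) ^ j := pow_le_pow_right₀ (by linarith) h
    have h4 : 2 * (q : ℝ) ^ i ≤ (q : ℝ) ^ (i + 1) := by
      rw [pow_succ]; nlinarith [hpos i]
    have := le_abs_self ((q : ℝ) ^ j - (q : ℝ) ^ i)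
    linarith [hpos i]
  · have h3 : (q : ℝ) ^ (j + 1) ≤ (q : ℝ) ^ i := pow_le_pow_right₀ (by linarith) h
    have h4 : 2 * (q : ℝ) ^ j ≤ (q : ℝ) ^ (j + 1) := by
      rw [pow_succ]; nlinarith [hpos j]
    have := neg_abs_le ((q : ℝ) ^ j - (q : ℝ) ^ i)
    linarith [hpos i]

lemma norm_one_sub_le {q : ℕ} (hq : 2 ≤ q) {j : ℕ} (hj : 2 ≤ j) :
    ‖(1 : ℂ) - (q : ℂ)‖ ≤ 2 / 2 ^ j * ‖(q : ℂ) ^ j - (q : ℂ)‖ := by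
  have hq' : (2 : ℝ) ≤ q := by exact_mod_cast hq
  obtain ⟨k, rfl⟩ : ∃ k, j = k + 2 := ⟨j - 2, by omega⟩
  have hk : (1 : ℝ) ≤ (q : ℝ) ^ k := one_le_pow₀ (by linarith)
  have h1 : ‖(1 : ℂ) - (q : ℂ)‖ = (q : ℝ) - 1 := by
    have : (1 : ℂ) - (q : ℂ) = ((1 - (q : ℝ) : ℝ) : ℂ) := by push_cast; ring
    rw [this, Complex.norm_real, Real.norm_eq_abs, abs_sub_comm, abs_of_nonneg]
    linarith
  have h2 : ‖(q : ℂ) ^ (k + 2) - (q : ℂ)‖ = (q : ℝ) ^ (k + 2) - q := by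
    have : (q : ℂ) ^ (k + 2) - (q : ℂ) = (((q : ℝ) ^ (k + 2) - q : ℝ) : ℂ) := by push_cast; ring
    rw [this, Complex.norm_real, Real.norm_eq_abs, abs_of_nonneg]
    rw [pow_add]; nlinarith
  rw [h1, h2, div_mul_eq_mul_div, le_div_iff₀ (by positivity)]
  have h3 : (2 : ℝ) ^ k ≤ (q : ℝ) ^ k := pow_le_pow_left₀ (by norm_num) hq' k
  have h4 : (q : ℝ) ^ (k + 2) - q = q * (q * (q : ℝ) ^ k - 1) := by ring
  have h5 : (q - 1) * (q : ℝ) ^ k ≤ q * (q : ℝ) ^ k - 1 := by linarith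
  have h6 : (2 : ℝ) ^ (k + 2) = 4 * 2 ^ k := by ring
  rw [h4, h6]
  have h7 : (q - 1) * (2 : ℝ) ^ k ≤ q * (q : ℝ) ^ k - 1 :=
    le_trans (mul_le_mul_of_nonneg_left h3 (by linarith)) h5
  have h8 : 0 ≤ (q - 1) * (2 : ℝ) ^ k := by
    have : 0 ≤ (q : ℝ) - 1 := by linarith
    positivity
  nlinarith

/-- For interpolation at `q` and at the `D` nodes `q ^ j` with `D + 3 ≤ j < 2 * D + 3`, the Lagrange
basis polynomial of a node `q ^ j` other than `q` is small at `1`. -/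
lemma norm_eval_one_lagrange_basis_le {q : ℕ} (hq : 2 ≤ q) {D j : ℕ}
    (hj : j ∈ Finset.Ico (D + 3) (2 * D + 3)) :
    ‖(Lagrange.basis (insert 1 (Finset.Ico (D + 3) (2 * D + 3)))
      (fun i => (q : ℂ) ^ i) j).eval 1‖ ≤ 2 ^ D / 2 ^ j := by
  have hinj : Function.Injective fun i : ℕ => q ^ i := Nat.pow_right_injective hq
  have hne : ∀ {i j : ℕ}, i ≠ j → (q : ℂ) ^ j - (q : ℂ) ^ i ≠ 0 := fun {i j} hij h =>
    hij (hinj (by exact_mod_cast (sub_eq_zero.mp h).symm))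
  have hj' := Finset.mem_Ico.mp hj
  have hs : (insert 1 (Finset.Ico (D + 3) (2 * D + 3))).erase j
      = insert 1 ((Finset.Ico (D + 3) (2 * D + 3)).erase j) :=
    Finset.erase_insert_of_ne (by omega)
  have hfac : ∀ i, i ≠ j → ‖(Lagrange.basisDivisor ((q : ℂ) ^ j) ((q : ℂ) ^ i)).eval 1‖
      = ‖(1 : ℂ) - (q : ℂ) ^ i‖ / ‖(q : ℂ) ^ j - (q : ℂ) ^ i‖ := by
    intro i hi
    simp [Lagrange.basisDivisor, div_eq_inv_mul]
  rw [Lagrange.basis, Polynomial.eval_prod, norm_prod, hs, Finset.prod_insert (by simp)]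
  have h1 : ‖(Lagrange.basisDivisor ((q : ℂ) ^ j) ((q : ℂ) ^ 1)).eval 1‖ ≤ 2 / 2 ^ j := by
    rw [hfac 1 (by omega), div_le_iff₀ (norm_pos_iff.mpr (hne (by omega))), pow_one]
    exact norm_one_sub_le hq (by omega)
  have h2 : ∏ i ∈ (Finset.Ico (D + 3) (2 * D + 3)).erase j,
      ‖(Lagrange.basisDivisor ((q : ℂ) ^ j) ((q : ℂ) ^ i)).eval 1‖ ≤ 2 ^ (D - 1) := by
    calc _ ≤ ∏ i ∈ (Finset.Ico (D + 3) (2 * D + 3)).erase j, (2 : ℝ) := by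
          refine Finset.prod_le_prod (fun _ _ => norm_nonneg _) fun i hi => ?_
          have hij := Finset.ne_of_mem_erase hi
          rw [hfac i hij, div_le_iff₀ (norm_pos_iff.mpr (hne hij))]
          exact norm_one_sub_pow_le hq hij
      _ = 2 ^ (D - 1) := by
          rw [Finset.prod_const, Finset.card_erase_of_mem hj, Nat.card_Ico]
          congr 1; omega
  calc _ ≤ (2 : ℝ) / 2 ^ j * 2 ^ (D - 1) :=
        mul_le_mul h1 h2 (Finset.prod_nonneg fun _ _ => norm_nonneg _) (by positivity)
    _ = 2 ^ D / 2 ^ j := by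
        obtain ⟨k, rfl⟩ : ∃ k, D = k + 1 := ⟨D - 1, by omega⟩
        rw [Nat.add_sub_cancel, pow_succ]; ring

/-- A polynomial of degree at most `D` that stays within distance `1` of its value at `q` on the
points `q ^ j` with `D + 3 ≤ j < 2 * D + 3` cannot move by more than `1 / 4` between `q` and `1`. -/
lemma norm_eval_one_sub_eval_le {q : ℕ} (hq : 2 ≤ q) {D : ℕ} {P : Polynomial ℂ}
    (hP : P.natDegree ≤ D)
    (hb : ∀ j ∈ Finset.Ico (D + 3) (2 * D + 3), ‖P.eval ((q : ℂ) ^ j) - P.eval (q : ℂ)‖ ≤ 1) :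
    ‖P.eval 1 - P.eval (q : ℂ)‖ ≤ 1 / 4 := by
  set s : Finset ℕ := insert 1 (Finset.Ico (D + 3) (2 * D + 3)) with hs
  set Q : Polynomial ℂ := P - Polynomial.C (P.eval (q : ℂ)) with hQ
  have hQe : ∀ x, Q.eval x = P.eval x - P.eval (q : ℂ) := fun x => by simp [hQ]
  have hinj : Function.Injective fun i : ℕ => (q : ℂ) ^ i := fun i j h => by
    have h' : (q : ℂ) ^ i = (q : ℂ) ^ j := h
    exact Nat.pow_right_injective hq (by exact_mod_cast h')
  have hcard : s.card = D + 1 := by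
    rw [hs, Finset.card_insert_of_notMem (by simp), Nat.card_Ico]; omega
  have hdeg : Q.degree < s.card := by
    refine lt_of_le_of_lt Polynomial.degree_le_natDegree ?_
    have : Q.natDegree ≤ D := by
      rw [hQ, Polynomial.natDegree_sub_C]; exact hP
    rw [hcard]
    exact_mod_cast Nat.lt_succ_of_le this
  have key : Q.eval 1 = ∑ j ∈ Finset.Ico (D + 3) (2 * D + 3),
      Q.eval ((q : ℂ) ^ j) * (Lagrange.basis s (fun i => (q : ℂ) ^ i) j).eval 1 := by
    conv_lhs => rw [Lagrange.eq_interpolate hinj.injOn hdeg]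
    rw [Lagrange.interpolate_apply, Polynomial.eval_finsetSum, hs,
      Finset.sum_insert (by simp)]
    -- the node `q` does not contribute because `Q` vanishes there
    simp [hQe]
  rw [← hQe, key]
  calc _ ≤ ∑ j ∈ Finset.Ico (D + 3) (2 * D + 3), (2 : ℝ) ^ D / 2 ^ j := by
        refine norm_sum_le_of_le _ fun j hj => ?_
        rw [norm_mul, hQe]
        have h := norm_eval_one_lagrange_basis_le hq hj
        exact le_trans (mul_le_of_le_one_left (norm_nonneg _) (hb j hj)) h
    _ = ∑ i ∈ Finset.range D, (1 / 8 : ℝ) * (1 / 2) ^ i := by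
        rw [Finset.sum_Ico_eq_sum_range, show 2 * D + 3 - (D + 3) = D by omega]
        refine Finset.sum_congr rfl fun i _ => ?_
        rw [pow_add, pow_add, one_div_pow]
        field_simp
        norm_num
    _ ≤ 1 / 4 := by
        rw [← Finset.mul_sum]
        linarith [sum_geometric_two_le D]

/-! ### Counting over the general linear group of a finite vector space -/

section Counting

variable {F V : Type*} [Field F] [AddCommGroup V] [Module F V]

lemma LinearIndependent.exists_linearEquiv_apply_eq [FiniteDimensional F V] {ι : Type*}
    {x u : ι → V} (hx : LinearIndependent F x) (hu : LinearIndependent F u) :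
    ∃ C : V ≃ₗ[F] V, ∀ i, C (x i) = u i := by
  obtain ⟨C, hC⟩ := Submodule.exists_linearEquiv_restrict_eq
    (hx.linearCombinationEquiv.symm ≪≫ₗ hu.linearCombinationEquiv)
  refine ⟨C, fun i => ?_⟩
  have h := hC (hx.linearCombinationEquiv (Finsupp.single i 1))
  rw [LinearEquiv.trans_apply, LinearEquiv.symm_apply_apply] at h
  simpa using h.symm

lemma natCard_linearEquiv_apply_eq [FiniteDimensional F V] {ι : Type*} {x u u' : ι → V}
    (hu : LinearIndependent F u) (hu' : LinearIndependent F u') :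
    Nat.card {B : V ≃ₗ[F] V // ∀ i, B (x i) = u i}
      = Nat.card {B : V ≃ₗ[F] V // ∀ i, B (x i) = u' i} := by
  obtain ⟨C, hC⟩ := hu.exists_linearEquiv_apply_eq hu'
  refine Nat.card_congr ((Equiv.mk (fun B => B ≪≫ₗ C) (fun B => B ≪≫ₗ C.symm)
    (fun B => ?_) (fun B => ?_)).subtypeEquiv fun B => ?_)
  · ext v; simp
  · ext v; simp
  · simp [← hC]

lemma natCard_linearEquiv_apply_eq' [FiniteDimensional F V] {ι : Type*} {v v' y : ι → V}
    (hv : LinearIndependent F v) (hv' : LinearIndependent F v') :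
    Nat.card {A : V ≃ₗ[F] V // ∀ i, A (v i) = y i}
      = Nat.card {A : V ≃ₗ[F] V // ∀ i, A (v' i) = y i} := by
  obtain ⟨C, hC⟩ := hv.exists_linearEquiv_apply_eq hv'
  refine Nat.card_congr ((Equiv.mk (fun B => C.symm ≪≫ₗ B) (fun B => C ≪≫ₗ B)
    (fun B => ?_) (fun B => ?_)).subtypeEquiv fun B => ?_)
  · ext v; simp
  · ext v; simp
  · simp [← hC]

lemma natCard_linearIndependent [Fintype F] [Finite V] (k : ℕ) :
    (Nat.card {u : Fin k → V // LinearIndependent F u} : ℂ)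
      = ∏ i ∈ Finset.range k,
        ((Fintype.card F : ℂ) ^ Module.finrank F V - (Fintype.card F : ℂ) ^ i) := by
  rcases le_or_gt k (Module.finrank F V) with h | h
  · rw [card_linearIndependent h, Nat.cast_prod, Finset.prod_range]
    refine Finset.prod_congr rfl fun i _ => ?_
    rw [Nat.cast_sub (Nat.pow_le_pow_right Fintype.card_pos (by omega))]
    push_cast; rfl
  · have : IsEmpty {u : Fin k → V // LinearIndependent F u} := by
      refine ⟨fun u => ?_⟩
      have := u.2.fintype_card_le_finrank
      rw [Fintype.card_fin] at this
      omega
    rw [Nat.card_of_isEmpty, Finset.prod_eq_zero (Finset.mem_range.mpr h) (sub_self _)]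
    simp

/-- A family in `V` is determined by its image under `E` together with a family in `ker E`. -/
noncomputable def linearIndependentLiftEquiv (E : V →ₗ[F] V) (r : ℕ) :
    {u : Fin r → V // LinearIndependent F (E ∘ u)} ≃
      {w : Fin r → LinearMap.range E // LinearIndependent F w} × (Fin r → LinearMap.ker E) where
  toFun u := (⟨E.rangeRestrict ∘ u.1, by
      refine LinearIndependent.of_comp (LinearMap.range E).subtype ?_
      exact u.2⟩,
    fun i => ⟨u.1 i - Function.surjInv E.surjective_rangeRestrict (E.rangeRestrict (u.1 i)), by
      have h := congrArg Subtype.val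
        (Function.surjInv_eq E.surjective_rangeRestrict (E.rangeRestrict (u.1 i)))
      simp only [LinearMap.rangeRestrict, LinearMap.codRestrict_apply] at h
      rw [LinearMap.mem_ker, map_sub, sub_eq_zero]
      exact h.symm⟩)
  invFun p := ⟨fun i => Function.surjInv E.surjective_rangeRestrict (p.1.1 i) + p.2 i, by
    have h : E ∘ (fun i => Function.surjInv E.surjective_rangeRestrict (p.1.1 i) + p.2 i)
        = (LinearMap.range E).subtype ∘ p.1.1 := by
      funext i
      have h := congrArg Subtype.val
        (Function.surjInv_eq E.surjective_rangeRestrict (p.1.1 i))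
      simp only [LinearMap.rangeRestrict, LinearMap.codRestrict_apply] at h
      simp only [Function.comp_apply, map_add, LinearMap.map_coe_ker, add_zero,
        Submodule.subtype_apply]
      exact h
    rw [h]
    exact p.1.2.map' _ (Submodule.ker_subtype _)⟩
  left_inv u := by
    ext i
    simp
  right_inv p := by
    have h : ∀ i, E.rangeRestrict
        (Function.surjInv E.surjective_rangeRestrict (p.1.1 i) + p.2 i) = p.1.1 i := by
      intro i
      rw [map_add, Function.surjInv_eq E.surjective_rangeRestrict (p.1.1 i)]
      have : E.rangeRestrict (p.2 i : V) = 0 := Subtype.ext (p.2 i).2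
      rw [this, add_zero]
    refine Prod.ext (Subtype.ext (funext h)) (funext fun i => Subtype.ext ?_)
    simp only [h]
    simp

lemma natCard_linearIndependent_comp [Fintype F] [Finite V] (E : V →ₗ[F] V) (r : ℕ) :
    (Nat.card {u : Fin r → V // LinearIndependent F (E ∘ u)} : ℂ)
      = ∏ i ∈ Finset.range r, ((Fintype.card F : ℂ) ^ Module.finrank F V
        - (Fintype.card F : ℂ) ^ Module.finrank F (LinearMap.ker E) * (Fintype.card F : ℂ) ^ i) := by
  rw [Nat.card_congr (linearIndependentLiftEquiv E r), Nat.card_prod, Nat.cast_mul,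
    natCard_linearIndependent, Nat.card_fun, Nat.card_fin,
    Module.natCard_eq_pow_finrank (K := F) (V := LinearMap.ker E), Nat.card_eq_fintype_card,
    Nat.cast_pow, Nat.cast_pow, ← LinearMap.finrank_range_add_finrank_ker E]
  conv_lhs => enter [2, 2]; rw [← Finset.card_range r]
  rw [← Finset.prod_const, ← Finset.prod_mul_distrib]
  exact Finset.prod_congr rfl fun i _ => by ring

/-- A family `Fin r ⊕ Fin s → V` that `E` maps to a linearly independent family on the first
summand and to `0` on the second is the same as a pair of families counted separately; the joint
linear independence is automatic. -/
def linearIndependentSumEquiv (E : V →ₗ[F] V) (r s : ℕ) :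
    {u : Fin r ⊕ Fin s → V // LinearIndependent F u ∧ LinearIndependent F (E ∘ u ∘ Sum.inl) ∧
      ∀ j, E (u (Sum.inr j)) = 0} ≃
      {u : Fin r → V // LinearIndependent F (E ∘ u)} ×
        {u : Fin s → LinearMap.ker E // LinearIndependent F u} where
  toFun u := (⟨u.1 ∘ Sum.inl, u.2.2.1⟩,
    ⟨fun j => ⟨u.1 (Sum.inr j), u.2.2.2 j⟩, by
      refine LinearIndependent.of_comp (LinearMap.ker E).subtype ?_
      exact u.2.1.comp Sum.inr Sum.inr_injective⟩)
  invFun p := ⟨Sum.elim p.1.1 (fun j => (p.2.1 j : V)), by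
    refine ⟨?_, p.1.2, fun j => (p.2.1 j).2⟩
    refine LinearIndependent.sum_type (.of_comp E p.1.2)
      (p.2.2.map' (LinearMap.ker E).subtype (Submodule.ker_subtype _)) ?_
    refine (Submodule.range_ker_disjoint p.1.2).mono_right (Submodule.span_le.mpr ?_)
    rintro _ ⟨j, rfl⟩
    exact (p.2.1 j).2⟩
  left_inv u := by
    ext (i | i) <;> rfl
  right_inv p := rfl

/-- The pairs `(A, B)` with `A E B` sending `x` to `y`, sorted by the family `u = B x`. -/
def linearEquivPairsEquiv (E : V →ₗ[F] V) {r s : ℕ} {x y : Fin r ⊕ Fin s → V}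
    (hx : LinearIndependent F x) (hy : LinearIndependent F (y ∘ Sum.inl))
    (hy0 : ∀ j, y (Sum.inr j) = 0) :
    {g : (V ≃ₗ[F] V) × (V ≃ₗ[F] V) // ∀ i, g.1 (E (g.2 (x i))) = y i} ≃
      Σ u : {u : Fin r ⊕ Fin s → V // LinearIndependent F u ∧
          LinearIndependent F (E ∘ u ∘ Sum.inl) ∧ ∀ j, E (u (Sum.inr j)) = 0},
        {B : V ≃ₗ[F] V // ∀ i, B (x i) = u.1 i} ×
          {A : V ≃ₗ[F] V // ∀ i, A ((E ∘ u.1 ∘ Sum.inl) i) = (y ∘ Sum.inl) i} where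
  toFun g := ⟨⟨fun i => g.1.2 (x i), by
      refine ⟨hx.map' g.1.2.toLinearMap g.1.2.ker, ?_, fun j => ?_⟩
      · refine LinearIndependent.of_comp g.1.1.toLinearMap ?_
        convert hy using 1
        exact funext fun i => g.2 (Sum.inl i)
      · have := g.2 (Sum.inr j)
        rwa [hy0, LinearEquiv.map_eq_zero_iff] at this⟩,
    ⟨g.1.2, fun _ => rfl⟩, ⟨g.1.1, fun i => g.2 (Sum.inl i)⟩⟩
  invFun p := ⟨(p.2.2.1, p.2.1.1), by
    rintro (i | j)
    · rw [p.2.1.2]; exact p.2.2.2 i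
    · rw [p.2.1.2, p.1.2.2.2, map_zero, hy0]⟩
  left_inv g := rfl
  right_inv p := by
    obtain ⟨⟨u, hu⟩, ⟨B, hB⟩, A, hA⟩ := p
    obtain rfl : (fun i => B (x i)) = u := funext hB
    rfl

lemma exists_natCard_pairs_eq [Fintype F] [Finite V] {r s : ℕ} {x y : Fin r ⊕ Fin s → V}
    (hx : LinearIndependent F x) (hy : LinearIndependent F (y ∘ Sum.inl))
    (hy0 : ∀ j, y (Sum.inr j) = 0) :
    ∃ P : Polynomial ℂ, P.natDegree ≤ r + s ∧ ∀ E : V →ₗ[F] V,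
      (Nat.card {g : (V ≃ₗ[F] V) × (V ≃ₗ[F] V) // ∀ i, g.1 (E (g.2 (x i))) = y i} : ℂ)
        = P.eval ((Fintype.card F : ℂ) ^ Module.finrank F (LinearMap.ker E)) := by
  classical
  set c : ℕ := Nat.card {B : V ≃ₗ[F] V // ∀ i, B (x i) = x i} with hc
  set c' : ℕ := Nat.card {A : V ≃ₗ[F] V //
    ∀ i, A ((y ∘ Sum.inl) i) = (y ∘ Sum.inl) i} with hc'
  refine ⟨Polynomial.C ((c : ℂ) * c') *
    ((∏ i ∈ Finset.range r, (Polynomial.C ((Fintype.card F : ℂ) ^ Module.finrank F V)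
        - Polynomial.X * Polynomial.C ((Fintype.card F : ℂ) ^ i))) *
      ∏ i ∈ Finset.range s, (Polynomial.X - Polynomial.C ((Fintype.card F : ℂ) ^ i))),
    ?_, fun E => ?_⟩
  · refine (Polynomial.natDegree_C_mul_le _ _).trans (Polynomial.natDegree_mul_le.trans ?_)
    refine add_le_add ?_ ?_
    · refine (Polynomial.natDegree_prod_le _ _).trans ?_
      refine (Finset.sum_le_card_nsmul _ _ 1 fun i _ => ?_).trans (by simp)
      compute_degree
    · refine (Polynomial.natDegree_prod_le _ _).trans ?_
      refine (Finset.sum_le_card_nsmul _ _ 1 fun i _ => ?_).trans (by simp)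
      compute_degree
  · have : Fintype {u : Fin r ⊕ Fin s → V // LinearIndependent F u ∧
      LinearIndependent F (E ∘ u ∘ Sum.inl) ∧ ∀ j, E (u (Sum.inr j)) = 0} := Fintype.ofFinite _
    have : Finite (V ≃ₗ[F] V) := DFunLike.finite _
    rw [Nat.card_congr (linearEquivPairsEquiv E hx hy hy0), Nat.card_sigma]
    rw [Finset.sum_congr rfl fun u _ => by
      rw [Nat.card_prod, natCard_linearEquiv_apply_eq u.2.1 hx,
        natCard_linearEquiv_apply_eq' u.2.2.1 hy, ← hc, ← hc']]
    rw [Finset.sum_const, Finset.card_univ, ← Nat.card_eq_fintype_card,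
      Nat.card_congr (linearIndependentSumEquiv E r s), Nat.card_prod, smul_eq_mul]
    push_cast
    rw [natCard_linearIndependent_comp, natCard_linearIndependent]
    simp only [Polynomial.eval_mul, Polynomial.eval_C, Polynomial.eval_prod, Polynomial.eval_sub,
      Polynomial.eval_X]
    ring

lemma LinearMap.exists_basis_sum_ker {M : Type*} [AddCommGroup M] [Module F M]
    [FiniteDimensional F M] (g : M →ₗ[F] V) :
    ∃ (r s : ℕ) (b : Module.Basis (Fin r ⊕ Fin s) F M),
      LinearIndependent F (fun i => g (b (Sum.inl i))) ∧ ∀ j, g (b (Sum.inr j)) = 0 := by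
  obtain ⟨C, hC⟩ := Submodule.exists_isCompl (LinearMap.ker g)
  refine ⟨_, _, ((Module.finBasis F C).prod (Module.finBasis F (LinearMap.ker g))).map
    (C.prodEquivOfIsCompl _ hC.symm), ?_, fun j => ?_⟩
  · have h := (Module.finBasis F C).linearIndependent.map' (g ∘ₗ C.subtype)
      (LinearMap.ker_eq_bot'.mpr fun p hp =>
        Subtype.ext (Submodule.disjoint_def.mp hC.disjoint p.1 hp p.2))
    simpa [Function.comp_def] using h
  · simp

/-- If no element `(0, y)` with `y ≠ 0` lies in `W ⊆ V × V`, then `W` has a basis `(x i, y i)`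
with `x` linearly independent and with `y` linearly independent on the first part of the index set
and zero on the second. -/
lemma exists_adapted_basis [FiniteDimensional F V] (W : Submodule F (V × V))
    (hW : ∀ p ∈ W, p.1 = 0 → p.2 = 0) :
    ∃ (r s : ℕ) (b : Module.Basis (Fin r ⊕ Fin s) F W),
      LinearIndependent F (fun i => (b i).1.1) ∧
      LinearIndependent F ((fun i => (b i).1.2) ∘ Sum.inl) ∧ ∀ j, (b (Sum.inr j)).1.2 = 0 := by
  obtain ⟨r, s, b, hb, hb0⟩ :=
    (LinearMap.snd F V V ∘ₗ W.subtype).exists_basis_sum_ker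
  refine ⟨r, s, b, ?_, hb, hb0⟩
  refine b.linearIndependent.map' (LinearMap.fst F V V ∘ₗ W.subtype) ?_
  exact LinearMap.ker_eq_bot'.mpr fun p hp => Subtype.ext (Prod.ext hp (hW p.1 p.2 hp))

/-- The number of pairs `(A, B)` of invertible maps for which `A E B` takes prescribed values on a
finite set is a polynomial in `|ker E|`, of degree at most the number of prescribed values. -/
lemma exists_natCard_interpolating_pairs_eq [Fintype F] [Finite V] (S : Finset (V × V)) :
    ∃ P : Polynomial ℂ, P.natDegree ≤ S.card ∧ ∀ E : V →ₗ[F] V,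
      (Nat.card {g : (V ≃ₗ[F] V) × (V ≃ₗ[F] V) // ∀ p ∈ S, g.1 (E (g.2 p.1)) = p.2} : ℂ)
        = P.eval ((Fintype.card F : ℂ) ^ Module.finrank F (LinearMap.ker E)) := by
  set W : Submodule F (V × V) := Submodule.span F (S : Set (V × V)) with hWdef
  have hgraph : ∀ f : V →ₗ[F] V, (∀ p ∈ S, f p.1 = p.2) ↔ W ≤ f.graph := fun f => by
    rw [hWdef, Submodule.span_le]
    exact forall₂_congr fun p _ => eq_comm
  by_cases hW : ∀ p ∈ W, p.1 = 0 → p.2 = 0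
  · obtain ⟨r, s, b, hx, hy, hy0⟩ := exists_adapted_basis W hW
    obtain ⟨P, hP, hPE⟩ := exists_natCard_pairs_eq hx hy hy0
    refine ⟨P, hP.trans ?_, fun E => ?_⟩
    · have := Module.finrank_eq_card_basis b
      rw [Fintype.card_sum, Fintype.card_fin, Fintype.card_fin] at this
      rw [← this]
      exact finrank_span_finset_le_card S
    · rw [← hPE]
      congr 1
      refine Nat.card_congr (Equiv.subtypeEquivRight fun g => ?_)
      have h := hgraph (g.1.toLinearMap ∘ₗ E ∘ₗ g.2.toLinearMap)
      simp only [LinearMap.comp_apply, LinearEquiv.coe_coe] at h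
      rw [h]
      constructor
      · intro h i
        exact (h (b i).2).symm
      · intro h p hp
        have hb : (⊤ : Submodule F W) ≤ (LinearMap.graph
            (g.1.toLinearMap ∘ₗ E ∘ₗ g.2.toLinearMap)).comap W.subtype := by
          rw [← b.span_eq, Submodule.span_le]
          rintro _ ⟨i, rfl⟩
          exact (h i).symm
        exact hb (x := ⟨p, hp⟩) trivial
  · push Not at hW
    obtain ⟨p, hpW, hp1, hp2⟩ := hW
    refine ⟨0, by simp, fun E => ?_⟩
    have : IsEmpty {g : (V ≃ₗ[F] V) × (V ≃ₗ[F] V) // ∀ p ∈ S, g.1 (E (g.2 p.1)) = p.2} := by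
      refine ⟨fun g => hp2 ?_⟩
      have h := (hgraph (g.1.1.toLinearMap ∘ₗ E ∘ₗ g.1.2.toLinearMap)).mp g.2 hpW
      rw [LinearMap.mem_graph_iff, hp1, map_zero] at h
      exact h
    rw [Nat.card_of_isEmpty, Nat.cast_zero, Polynomial.eval_zero]

end Counting

/-! ### The polynomial method for oracle queries -/

section QueryPolynomials

/-- The indicator, as a function of the oracle `f`, that `f` takes the values prescribed by `S`. -/
noncomputable def agreementIndicator {X Y : Type*} (S : Finset (X × Y)) (f : X → Y) : ℂ :=
  open Classical in if ∀ p ∈ S, f p.1 = p.2 then 1 else 0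

lemma agreementIndicator_union {X Y : Type*} [DecidableEq X] [DecidableEq Y]
    (S S' : Finset (X × Y)) :
    agreementIndicator (S ∪ S') = agreementIndicator S * agreementIndicator S' := by
  funext f
  simp only [agreementIndicator, Pi.mul_apply, Finset.forall_mem_union, ite_and, ite_mul, one_mul,
    zero_mul]
  split_ifs <;> rfl

/-- The functions of the oracle `f : X → Y` that are polynomials of degree at most `k` in the
indicator variables `[f x = y]`. Monomials are multilinear since these variables are idempotent. -/
noncomputable def queryPolynomials (X Y : Type*) (k : ℕ) : Submodule ℂ ((X → Y) → ℂ) :=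
  Submodule.span ℂ (agreementIndicator '' {S : Finset (X × Y) | S.card ≤ k})

variable {X Y : Type*}

lemma agreementIndicator_mem_queryPolynomials {S : Finset (X × Y)} {k : ℕ} (hS : S.card ≤ k) :
    agreementIndicator S ∈ queryPolynomials X Y k :=
  Submodule.subset_span ⟨S, hS, rfl⟩

lemma const_mem_queryPolynomials (c : ℂ) :
    (fun _ => c) ∈ queryPolynomials X Y 0 := by
  have h := (queryPolynomials X Y 0).smul_mem c
    (agreementIndicator_mem_queryPolynomials (S := ∅) (by simp))
  convert h using 1
  funext f
  simp [agreementIndicator]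

lemma mul_mem_queryPolynomials {g h : (X → Y) → ℂ} {k l : ℕ}
    (hg : g ∈ queryPolynomials X Y k) (hh : h ∈ queryPolynomials X Y l) :
    g * h ∈ queryPolynomials X Y (k + l) := by
  classical
  have hmul := Submodule.mul_mem_mul hg hh
  rw [queryPolynomials, queryPolynomials, Submodule.span_mul_span] at hmul
  refine Submodule.span_mono ?_ hmul
  rintro _ ⟨_, ⟨S, hS, rfl⟩, _, ⟨S', hS', rfl⟩, rfl⟩
  exact ⟨S ∪ S', (Finset.card_union_le S S').trans (add_le_add hS hS'),
    agreementIndicator_union S S'⟩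

lemma conj_mem_queryPolynomials {g : (X → Y) → ℂ} {k : ℕ} (hg : g ∈ queryPolynomials X Y k) :
    (fun f => (starRingEnd ℂ) (g f)) ∈ queryPolynomials X Y k := by
  induction hg using Submodule.span_induction with
  | mem g hg =>
    obtain ⟨S, hS, rfl⟩ := hg
    convert agreementIndicator_mem_queryPolynomials hS using 1
    funext f
    simp only [agreementIndicator]
    split_ifs <;> simp
  | zero => simpa [Pi.zero_def] using (queryPolynomials X Y k).zero_mem
  | add g h _ _ hg hh => simpa [Pi.add_def] using (queryPolynomials X Y k).add_mem hg hh
  | smul c g _ hg =>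
    simpa [Pi.smul_def] using (queryPolynomials X Y k).smul_mem ((starRingEnd ℂ) c) hg

lemma sum_mul_mem_queryPolynomials {ι : Type*} (s : Finset ι) {k : ℕ} (c : ι → ℂ)
    {g : ι → (X → Y) → ℂ} (hg : ∀ i ∈ s, g i ∈ queryPolynomials X Y k) :
    (fun f => ∑ i ∈ s, c i * g i f) ∈ queryPolynomials X Y k := by
  have h := Submodule.sum_mem (queryPolynomials X Y k) fun i hi =>
    (queryPolynomials X Y k).smul_mem (c i) (hg i hi)
  convert h using 1
  funext f
  simp

/-- A query multiplies by the indicators `[f x = y]`, hence raises the degree by one. -/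
lemma applyOracle_mem_queryPolynomials [Fintype Y] [AddGroup Y] {m k : ℕ}
    {ψ : (X → Y) → StateVec X Y m} (hψ : ∀ z, (fun f => ψ f z) ∈ queryPolynomials X Y k)
    (z : BasisIndex X Y m) :
    (fun f => applyOracle f (ψ f) z) ∈ queryPolynomials X Y (k + 1) := by
  classical
  have h := Submodule.sum_mem (queryPolynomials X Y (k + 1))
    (t := (Finset.univ : Finset Y)) fun y _ =>
    mul_mem_queryPolynomials (hψ (z.1, z.2.1 - y, z.2.2))
      (agreementIndicator_mem_queryPolynomials (S := {(z.1, y)}) (k := 1) (by simp))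
  convert h using 1
  funext f
  simp [applyOracle, agreementIndicator]

namespace QueryAlgorithm

variable [Fintype X] [DecidableEq X] [Fintype Y] [DecidableEq Y] {T : ℕ}

lemma stateAfter_zero [Zero X] [AddGroup Y] (A : QueryAlgorithm X Y T) (f : X → Y) :
    A.stateAfter f 0 = (A.U 0 : Matrix _ _ ℂ) *ᵥ A.initState := rfl

lemma stateAfter_succ [Zero X] [AddGroup Y] (A : QueryAlgorithm X Y T) (f : X → Y) (i : Fin T) :
    A.stateAfter f i.succ
      = (A.U i.succ : Matrix _ _ ℂ) *ᵥ applyOracle f (A.stateAfter f i.castSucc) := by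
  simp only [stateAfter, Fin.induction_succ]

/-- The amplitudes after `t` queries are polynomials of degree at most `t` in the oracle. -/
lemma stateAfter_mem_queryPolynomials [Zero X] [AddGroup Y] (A : QueryAlgorithm X Y T)
    (t : Fin (T + 1)) (z : BasisIndex X Y A.workDim) :
    (fun f => A.stateAfter f t z) ∈ queryPolynomials X Y t := by
  induction t using Fin.induction generalizing z with
  | zero => exact const_mem_queryPolynomials _
  | succ i ih =>
    simp only [stateAfter_succ, Matrix.mulVec, dotProduct]
    exact sum_mul_mem_queryPolynomials _ _ fun w _ =>
      applyOracle_mem_queryPolynomials (fun z => ih z) w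

/-- The acceptance probability of a `T`-query algorithm is a polynomial of degree at most `2 T` in
the oracle, being a sum of squared moduli of amplitudes. -/
lemma outputProb_mem_queryPolynomials [Zero X] [AddGroup Y] (A : QueryAlgorithm X Y T)
    (a : Bool) :
    (fun f => (A.outputProb f a : ℂ)) ∈ queryPolynomials X Y (2 * T) := by
  have h := sum_mul_mem_queryPolynomials (Finset.univ : Finset (BasisIndex X Y A.workDim))
    (fun z => if A.output z = a then 1 else 0) fun z _ =>
      mul_mem_queryPolynomials (A.stateAfter_mem_queryPolynomials (Fin.last T) z)
        (conj_mem_queryPolynomials (A.stateAfter_mem_queryPolynomials (Fin.last T) z))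
  rw [Fin.val_last, ← two_mul] at h
  convert h using 1
  funext f
  simp only [outputProb, finalState, Complex.ofReal_sum, Pi.mul_apply, Complex.mul_conj']
  refine Finset.sum_congr rfl fun z _ => ?_
  split_ifs <;> simp

end QueryAlgorithm

end QueryPolynomials

/-! ### Output probabilities -/

lemma sum_norm_sq_unitary_mulVec {ι : Type*} [Fintype ι] [DecidableEq ι]
    (U : Matrix.unitaryGroup ι ℂ) (ψ : ι → ℂ) :
    ∑ z, ‖((U : Matrix ι ι ℂ) *ᵥ ψ) z‖ ^ 2 = ∑ z, ‖ψ z‖ ^ 2 := by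
  have h : ∀ φ : ι → ℂ, ((∑ z, ‖φ z‖ ^ 2 : ℝ) : ℂ) = star φ ⬝ᵥ φ := fun φ => by
    simp [dotProduct, Complex.conj_mul']
  have hU : star (U : Matrix ι ι ℂ) * (U : Matrix ι ι ℂ) = 1 :=
    Matrix.UnitaryGroup.star_mul_self U
  have : ((∑ z, ‖((U : Matrix ι ι ℂ) *ᵥ ψ) z‖ ^ 2 : ℝ) : ℂ) = ((∑ z, ‖ψ z‖ ^ 2 : ℝ) : ℂ) := by
    rw [h, h, Matrix.star_mulVec, Matrix.dotProduct_mulVec, Matrix.vecMul_vecMul,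
      ← Matrix.star_eq_conjTranspose, hU, Matrix.vecMul_one]
  exact_mod_cast this

lemma sum_norm_sq_applyOracle {X Y : Type*} [Fintype X] [Fintype Y] [AddGroup Y] {m : ℕ}
    (f : X → Y) (ψ : StateVec X Y m) :
    ∑ z, ‖applyOracle f ψ z‖ ^ 2 = ∑ z, ‖ψ z‖ ^ 2 := by
  simp only [applyOracle, Fintype.sum_prod_type]
  exact Finset.sum_congr rfl fun x _ =>
    (Equiv.subRight (f x)).sum_comp fun y => ∑ w, ‖ψ (x, y, w)‖ ^ 2

namespace QueryAlgorithm

variable {X Y : Type*} [Fintype X] [DecidableEq X] [Fintype Y] [DecidableEq Y] {T : ℕ}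
  [Zero X] [AddGroup Y]

lemma sum_norm_sq_stateAfter (A : QueryAlgorithm X Y T) (f : X → Y) (t : Fin (T + 1)) :
    ∑ z, ‖A.stateAfter f t z‖ ^ 2 = 1 := by
  induction t using Fin.induction with
  | zero =>
    rw [stateAfter_zero, sum_norm_sq_unitary_mulVec, initState]
    rw [Finset.sum_eq_single_of_mem _ (Finset.mem_univ (0, 0, ⟨0, A.workDim_pos⟩))]
    · simp
    · intro z _ hz
      simp [Pi.single_eq_of_ne hz]
  | succ i ih => rw [stateAfter_succ, sum_norm_sq_unitary_mulVec, sum_norm_sq_applyOracle, ih]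

lemma outputProb_nonneg (A : QueryAlgorithm X Y T) (f : X → Y) (a : Bool) :
    0 ≤ A.outputProb f a :=
  Finset.sum_nonneg fun z _ => by split_ifs <;> positivity

lemma outputProb_true_add_false (A : QueryAlgorithm X Y T) (f : X → Y) :
    A.outputProb f true + A.outputProb f false = 1 := by
  rw [outputProb, outputProb, ← Finset.sum_add_distrib,
    ← A.sum_norm_sq_stateAfter f (Fin.last T)]
  refine Finset.sum_congr rfl fun z _ => ?_
  cases A.output z <;> simp [finalState]

end QueryAlgorithm

/-! ### Symmetrization over linear maps with a kernel of given dimension -/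

/-- Averaging over the maps `A E B` with `A`, `B` invertible turns a polynomial in the oracle into a
univariate polynomial in `|ker E|` of no larger degree. -/
lemma exists_sum_queryPolynomial_eq {F V : Type*} [Field F] [AddCommGroup V] [Module F V]
    [Fintype F] [Finite V] [Fintype (V ≃ₗ[F] V)] {k : ℕ} {g : (V → V) → ℂ}
    (hg : g ∈ queryPolynomials V V k) :
    ∃ P : Polynomial ℂ, P.natDegree ≤ k ∧ ∀ E : V →ₗ[F] V,
      ∑ p : (V ≃ₗ[F] V) × (V ≃ₗ[F] V),
          g (p.1.toLinearMap ∘ₗ E ∘ₗ p.2.toLinearMap : V →ₗ[F] V)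
        = P.eval ((Fintype.card F : ℂ) ^ Module.finrank F (LinearMap.ker E)) := by
  classical
  induction hg using Submodule.span_induction with
  | mem g hg =>
    obtain ⟨S, hS, rfl⟩ := hg
    obtain ⟨P, hP, hPE⟩ := exists_natCard_interpolating_pairs_eq (F := F) S
    refine ⟨P, hP.trans hS, fun E => ?_⟩
    rw [← hPE, Nat.card_eq_fintype_card, Fintype.card_subtype]
    simp [agreementIndicator]
  | zero => exact ⟨0, by simp, by simp⟩
  | add g h _ _ hg hh =>
    obtain ⟨P, hP, hPE⟩ := hg
    obtain ⟨Q, hQ, hQE⟩ := hh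
    refine ⟨P + Q, Polynomial.natDegree_add_le_of_degree_le hP hQ, fun E => ?_⟩
    rw [Polynomial.eval_add, ← hPE, ← hQE, ← Finset.sum_add_distrib]
    rfl
  | smul c g _ hg =>
    obtain ⟨P, hP, hPE⟩ := hg
    refine ⟨Polynomial.C c * P, (Polynomial.natDegree_C_mul_le _ _).trans hP, fun E => ?_⟩
    rw [Polynomial.eval_mul, Polynomial.eval_C, ← hPE, Finset.mul_sum]
    rfl

lemma exists_linearMap_finrank_ker_eq (F : Type*) [Field F] {n d : ℕ} (hd : d ≤ n) :
    ∃ E : (Fin n → F) →ₗ[F] (Fin n → F), Module.finrank F (LinearMap.ker E) = d := by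
  classical
  set w : Fin n → F := fun i => if (i : ℕ) < d then 0 else 1 with hw
  refine ⟨(Matrix.diagonal w).mulVecLin, ?_⟩
  have h1 := LinearMap.finrank_range_add_finrank_ker (Matrix.diagonal w).mulVecLin
  have h2 := Matrix.rank_diagonal w
  have h3 : Fintype.card {i // w i ≠ 0} = n - d := by
    have h4 : ∀ i, w i ≠ 0 ↔ ¬ (i : ℕ) < d := fun i => by
      simp [hw]
    rw [Fintype.card_congr (Equiv.subtypeEquivRight h4), Fintype.card_subtype_compl,
      Fintype.card_fin, Fintype.card_subtype, Fin.card_filter_val_lt, min_eq_right hd]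
  rw [Matrix.rank, h3] at h2
  rw [Module.finrank_fin_fun] at h1
  omega

lemma finrank_ker_comp_linearEquiv {F V : Type*} [Field F] [AddCommGroup V] [Module F V]
    (A B : V ≃ₗ[F] V) (E : V →ₗ[F] V) :
    Module.finrank F (LinearMap.ker (A.toLinearMap ∘ₗ E ∘ₗ B.toLinearMap))
      = Module.finrank F (LinearMap.ker E) := by
  rw [LinearEquiv.ker_comp, LinearMap.ker_comp]
  exact (B.submoduleMap _).finrank_eq.trans (by
    rw [Submodule.map_comap_eq_of_surjective B.surjective])

/-- The acceptance probability averaged over `A E B` is a polynomial in `q ^ dim ker E` of degree at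
most `2 T`. It moves by at least `1 / 3` between `1` and `q` and stays in `[0, 1]` at
`q ^ 2, …, q ^ n`, which is impossible when `T` is small compared with `n`. -/
lemma le_of_solvesLinearSimon {F : Type*} [Field F] [Fintype F] [DecidableEq F] {n T : ℕ}
    (A : QueryAlgorithm (Fin n → F) (Fin n → F) T) (hA : SolvesLinearSimon A (2 / 3)) :
    n ≤ 5 * T := by
  by_contra! hn
  have : Finite ((Fin n → F) ≃ₗ[F] (Fin n → F)) := DFunLike.finite _
  have : Fintype ((Fin n → F) ≃ₗ[F] (Fin n → F)) := Fintype.ofFinite _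
  set G := ((Fin n → F) ≃ₗ[F] (Fin n → F)) × ((Fin n → F) ≃ₗ[F] (Fin n → F)) with hG
  set q := Fintype.card F with hq
  have hq2 : 2 ≤ q := Fintype.one_lt_card
  have hN : (0 : ℝ) < Fintype.card G := by exact_mod_cast Fintype.card_pos
  -- the average of the acceptance probability over the orbit of `E`
  set avg : ((Fin n → F) →ₗ[F] (Fin n → F)) → ℝ := fun E =>
    (∑ p : G, A.outputProb (p.1.toLinearMap ∘ₗ E ∘ₗ p.2.toLinearMap :
      (Fin n → F) →ₗ[F] (Fin n → F)) true) / Fintype.card G with havg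
  obtain ⟨P₀, hP₀, hP₀E⟩ := exists_sum_queryPolynomial_eq (F := F)
    (A.outputProb_mem_queryPolynomials true)
  set P : Polynomial ℂ := Polynomial.C ((Fintype.card G : ℂ)⁻¹) * P₀ with hPdef
  have hP : P.natDegree ≤ 2 * T := (Polynomial.natDegree_C_mul_le _ _).trans hP₀
  have hPE : ∀ E, P.eval ((q : ℂ) ^ Module.finrank F (LinearMap.ker E)) = (avg E : ℂ) := by
    intro E
    rw [hPdef, Polynomial.eval_mul, Polynomial.eval_C, ← hP₀E, havg]
    push_cast
    rw [div_eq_inv_mul]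
  have hle : ∀ E (c : ℝ), (∀ p : G, A.outputProb (p.1.toLinearMap ∘ₗ E ∘ₗ p.2.toLinearMap :
      (Fin n → F) →ₗ[F] (Fin n → F)) true ≤ c) → avg E ≤ c := by
    intro E c h
    rw [havg, div_le_iff₀ hN]
    refine (Finset.sum_le_card_nsmul _ _ c fun p _ => h p).trans ?_
    rw [Finset.card_univ, nsmul_eq_mul, mul_comm]
  have hge : ∀ E (c : ℝ), (∀ p : G, c ≤ A.outputProb (p.1.toLinearMap ∘ₗ E ∘ₗ p.2.toLinearMap :
      (Fin n → F) →ₗ[F] (Fin n → F)) true) → c ≤ avg E := by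
    intro E c h
    rw [havg, le_div_iff₀ hN]
    refine le_trans ?_ (Finset.card_nsmul_le_sum _ _ c fun p _ => h p)
    rw [Finset.card_univ, nsmul_eq_mul, mul_comm]
  have hcard : ∀ f : (Fin n → F) →ₗ[F] (Fin n → F),
      Nat.card (LinearMap.ker f) = q ^ Module.finrank F (LinearMap.ker f) := fun f => by
    rw [Module.natCard_eq_pow_finrank (K := F), Nat.card_eq_fintype_card]
  have hle1 : ∀ E, avg E ≤ 1 := fun E => hle E 1 fun p => by
    linarith [A.outputProb_true_add_false (p.1.toLinearMap ∘ₗ E ∘ₗ p.2.toLinearMap :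
      (Fin n → F) →ₗ[F] (Fin n → F)), A.outputProb_nonneg (p.1.toLinearMap ∘ₗ E ∘ₗ
        p.2.toLinearMap : (Fin n → F) →ₗ[F] (Fin n → F)) false]
  have hge0 : ∀ E, 0 ≤ avg E := fun E => hge E 0 fun p => A.outputProb_nonneg _ _
  obtain ⟨E₀, hE₀⟩ := exists_linearMap_finrank_ker_eq F (n := n) (d := 0) (by omega)
  obtain ⟨E₁, hE₁⟩ := exists_linearMap_finrank_ker_eq F (n := n) (d := 1) (by omega)
  have h0 : 2 / 3 ≤ avg E₀ := hge E₀ _ fun p => (hA _).1 <| by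
    rw [hcard, finrank_ker_comp_linearEquiv, hE₀, pow_zero]
  have h1 : avg E₁ ≤ 1 / 3 := hle E₁ _ fun p => by
    have h := (hA (p.1.toLinearMap ∘ₗ E₁ ∘ₗ p.2.toLinearMap)).2 <| by
      rw [hcard, finrank_ker_comp_linearEquiv, hE₁, pow_one]
    linarith [A.outputProb_true_add_false (p.1.toLinearMap ∘ₗ E₁ ∘ₗ p.2.toLinearMap :
      (Fin n → F) →ₗ[F] (Fin n → F))]
  have e0 := hPE E₀
  have e1 := hPE E₁
  rw [hE₀, pow_zero] at e0
  rw [hE₁, pow_one] at e1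
  have hfin := norm_eval_one_sub_eval_le hq2 hP fun j hj => by
    -- for `T = 0` there are no such `j`, and otherwise `j ≤ 4 T + 2 ≤ n`
    obtain ⟨E, hE⟩ := exists_linearMap_finrank_ker_eq F (n := n) (d := j)
      (by have := Finset.mem_Ico.mp hj; omega)
    rw [← hE, hPE, e1, ← Complex.ofReal_sub, Complex.norm_real, Real.norm_eq_abs, abs_le]
    constructor <;> linarith [hle1 E, hge0 E, hle1 E₁, hge0 E₁]
  rw [e0, e1, ← Complex.ofReal_sub, Complex.norm_real, Real.norm_eq_abs] at hfin
  linarith [le_abs_self (avg E₀ - avg E₁)]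

theorem theorem1 :
    ∃ c : ℝ, 0 < c ∧
      ∀ (F : Type*) [Field F] [Fintype F] [DecidableEq F] (n T : ℕ)
        (A : QueryAlgorithm (Fin n → F) (Fin n → F) T),
        SolvesLinearSimon A (2 / 3) → c * (n : ℝ) ≤ (T : ℝ) := by
  refine ⟨1 / 5, by norm_num, fun F _ _ _ n T A hA => ?_⟩
  have h : (n : ℝ) ≤ 5 * T := by exact_mod_cast le_of_solvesLinearSimon A hA
  linarith
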